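/- Let $d\in\mathbb{N}$ and let $\mathcal{M}$ be the space of all Radon measures on $\mathbb{R}^d$, equipped with the weak (vague) topology, i.e. the coarsest topology for which $\mu\mapsto\int\phi\,d\mu$ is continuous for every compactly supported continuous $\phi:\mathbb{R}^d\to\mathbb{R}$; thus $\mu_i\to\mu$ if and only if $\int\phi\,d\mu_i\to\int\phi\,d\mu$ for all such $\phi$. For $\mu\in\mathcal{M}$, $x\in\mathbb{R}^d$ and $r>0$ let $T_{x,r\sharp}\mu$ be the push-forward of $\mu$ under $T_{x,r}(y)=(y-x)/r$. A measure $\nu\in\mathcal{M}\setminus\{0\}$ is a tangent measure of $\mu$ at $x$ if there are $r_i\searrow 0$ and $c_i>0$ such that $c_iT_{x,r_i\sharp}\mu\to\nu$ as $i\to\infty$; the set of all tangent measures of $\mu$ at $x$ is denoted by $\operatorname{Tan}(\mu,x)$. Then the set of all $\mu\in\mathcal{M}$ such that $\operatorname{Tan}(\mu,x)=\mathcal{M}\setminus\{0\}$ for $\mu$-almost every $x\in\mathbb{R}^d$ is residual in $\mathcal{M}$, that is, its complement is meagre (a countable union of sets whose closures have empty interior). -/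

import Mathlib

open MeasureTheory Filter Topology
open scoped NNReal CompactlySupported

noncomputable section

/-- The space `𝓜` of all Radon measures on `ℝ^d`. -/
def RadonMeasure (d : ℕ) : Type :=
  {μ : Measure (EuclideanSpace ℝ (Fin d)) // μ.Regular}

namespace RadonMeasure

variable {d : ℕ}

/-- The underlying Borel measure of a Radon measure. -/
def toMeasure (μ : RadonMeasure d) : Measure (EuclideanSpace ℝ (Fin d)) := μ.1

/-- The zero measure. -/
instance : Zero (RadonMeasure d) := ⟨⟨0, inferInstance⟩⟩

/-- The weak (vague) topology: the coarsest topology for which `μ ↦ ∫ φ dμ` is continuous for every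
compactly supported continuous `φ : ℝ^d → ℝ`. -/
instance : TopologicalSpace (RadonMeasure d) :=
  TopologicalSpace.induced
    (fun (μ : RadonMeasure d) (φ : C_c(EuclideanSpace ℝ (Fin d), ℝ)) => ∫ y, φ y ∂μ.toMeasure)
    inferInstance

/-- Scaled push-forwards of Radon measures under homotheties are Radon. -/
theorem regular_blowUp (μ : RadonMeasure d) (x : EuclideanSpace ℝ (Fin d)) {r : ℝ} (hr : 0 < r)
    (c : ℝ≥0) : (c • μ.toMeasure.map (fun y => r⁻¹ • (y - x))).Regular := by
  have : μ.toMeasure.Regular := μ.2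
  have : (μ.toMeasure.map (fun y => r⁻¹ • (y - x))).Regular :=
    Measure.Regular.map
      ((Homeomorph.subRight x).trans (Homeomorph.smulOfNeZero r⁻¹ (inv_ne_zero hr.ne')))
  exact Measure.Regular.smul_nnreal c

/-- The blow-up `c T_{x,r♯} μ`, where `T_{x,r}(y) = (y - x) / r` maps the closed ball `B(x,r)` onto
`B(0,1)`. -/
def blowUp (μ : RadonMeasure d) (x : EuclideanSpace ℝ (Fin d)) {r : ℝ} (hr : 0 < r)
    (c : ℝ≥0) : RadonMeasure d :=
  ⟨c • μ.toMeasure.map (fun y => r⁻¹ • (y - x)), regular_blowUp μ x hr c⟩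

/-- The set `Tan(μ,x)` of tangent measures of `μ` at `x`: the nonzero Radon measures `ν` that are
limits of `c_i T_{x,r_i♯} μ` in the weak topology, for some radii `r_i > 0` decreasing to `0` and
some constants `c_i > 0`. -/
def tangentMeasures (μ : RadonMeasure d) (x : EuclideanSpace ℝ (Fin d)) : Set (RadonMeasure d) :=
  {ν | ν ≠ 0 ∧ ∃ (r : ℕ → ℝ) (hr : ∀ i, 0 < r i) (c : ℕ → ℝ≥0),
    StrictAnti r ∧ Tendsto r atTop (𝓝 0) ∧ (∀ i, 0 < c i) ∧
      Tendsto (fun i => μ.blowUp x (hr i) (c i)) atTop (𝓝 ν)}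

end RadonMeasure

end

namespace RadonMeasure

variable {d : ℕ}

/-! The vague topology is second countable, so it suffices to fix one nonempty open `U` and one `δ >
0` and show that for residually many `μ`, almost every `x` is good, i.e. has a blow-up in `U` at a
scale below `δ`. Countably many conditions then combine, and a recursive choice of radii gives every
`ν ≠ 0` as a tangent measure.

For compact `K` and `ε > 0`, the measures whose bad points in `K` have mass below `ε` form an open
set (`isOpen_mostlyGood`: joint continuity of blow-ups, a tube argument, upper semicontinuity of
mass on compact sets).

This set is dense (`dense_mostlyGood`). Finitely supported measures are dense, so `U` contains one,
`η`, with an atom at `0`. Replacing each atom of a discrete measure by a tiny copy of normalized `η`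
barely moves the measure and makes the old atoms good. The atom at `0` leaves a fixed share of the
mass there, so only a proportion `q < 1` stays bad. Repeating this on the bad part alone keeps the
good points good, by openness, and the bad mass decays like `q ^ n`. -/

/-! ### Evaluations and second countability of the vague topology. -/

instance (μ : RadonMeasure d) : μ.toMeasure.Regular := μ.2

/-- The embedding of Radon measures into the functions on `C_c(ℝ^d, ℝ)`. -/
noncomputable def ev (μ : RadonMeasure d) (φ : C_c(EuclideanSpace ℝ (Fin d), ℝ)) : ℝ :=
  ∫ y, φ y ∂μ.toMeasure

theorem isInducing_ev : IsInducing (ev (d := d)) := ⟨rfl⟩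

theorem continuous_ev (φ : C_c(EuclideanSpace ℝ (Fin d), ℝ)) :
    Continuous fun μ : RadonMeasure d => μ.ev φ :=
  (continuous_apply φ).comp isInducing_ev.continuous

theorem continuous_iff_ev {X : Type*} [TopologicalSpace X] {f : X → RadonMeasure d} :
    Continuous f ↔ ∀ φ, Continuous fun x => (f x).ev φ :=
  isInducing_ev.continuous_iff.trans continuous_pi_iff

theorem integrable (μ : RadonMeasure d) (φ : C_c(EuclideanSpace ℝ (Fin d), ℝ)) :
    Integrable φ μ.toMeasure :=
  φ.continuous.integrable_of_hasCompactSupport φ.hasCompactSupport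

theorem abs_ev_sub_ev_le (μ : RadonMeasure d) {φ ψ χ : C_c(EuclideanSpace ℝ (Fin d), ℝ)} {δ : ℝ}
    (h : ∀ x, |φ x - ψ x| ≤ δ * χ x) : |μ.ev φ - μ.ev ψ| ≤ δ * μ.ev χ := by
  unfold ev
  rw [← integral_sub (μ.integrable φ) (μ.integrable ψ), ← integral_const_mul]
  refine (abs_integral_le_integral_abs).trans ?_
  exact integral_mono ((μ.integrable φ).sub (μ.integrable ψ)).abs
    ((μ.integrable χ).const_mul δ) h

/-- A compactly supported cutoff function between a compact set and an open neighbourhood. -/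
theorem exists_cutoff {K V : Set (EuclideanSpace ℝ (Fin d))} (hK : IsCompact K) (hV : IsOpen V)
    (hKV : K ⊆ V) : ∃ χ : C_c(EuclideanSpace ℝ (Fin d), ℝ),
      (∀ x ∈ K, χ x = 1) ∧ (∀ x ∉ V, χ x = 0) ∧ (∀ x, 0 ≤ χ x) ∧ ∀ x, χ x ≤ 1 := by
  obtain ⟨f, h1, h0, hc, h⟩ := exists_continuous_one_zero_of_isCompact hK hV.isClosed_compl
    (Set.disjoint_compl_right_iff_subset.2 hKV)
  exact ⟨⟨f, hc⟩, h1, h0, fun x => (h x).1, fun x => (h x).2⟩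

theorem exists_cutoff_ball (R : ℝ) : ∃ χ : C_c(EuclideanSpace ℝ (Fin d), ℝ),
    (∀ x, ‖x‖ ≤ R → χ x = 1) ∧ ∀ x, 0 ≤ χ x := by
  obtain ⟨χ, h1, -, h0, -⟩ := exists_cutoff (d := d) (isCompact_closedBall 0 R) isOpen_univ
    (Set.subset_univ _)
  exact ⟨χ, fun x hx => h1 x (by simpa using hx), h0⟩

theorem exists_support_bound (φ : C_c(EuclideanSpace ℝ (Fin d), ℝ)) :
    ∃ N : ℕ, ∀ x, (N : ℝ) < ‖x‖ → φ x = 0 := by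
  obtain ⟨R, hR⟩ := φ.hasCompactSupport.isBounded.exists_norm_le
  obtain ⟨N, hN⟩ := exists_nat_ge R
  refine ⟨N, fun x hx => ?_⟩
  by_contra h
  exact absurd (hR x (subset_tsupport _ h)) (by linarith)

/-- Countably many test functions approximate all the others, uniformly and with controlled
supports. -/
theorem exists_countable_test : ∃ Φ : Set C_c(EuclideanSpace ℝ (Fin d), ℝ), Φ.Countable ∧
    ∀ φ : C_c(EuclideanSpace ℝ (Fin d), ℝ), ∃ χ ∈ Φ, ∀ δ > 0, ∃ ψ ∈ Φ,
      ∀ x, |φ x - ψ x| ≤ δ * χ x := by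
  let S : ℕ → Set C_c(EuclideanSpace ℝ (Fin d), ℝ) :=
    fun N => {φ | ∀ x, (N : ℝ) < ‖x‖ → φ x = 0}
  choose χ hχ1 hχ0 using fun N : ℕ => exists_cutoff_ball (d := d) N
  have key : ∀ N, ∃ T ⊆ S N, T.Countable ∧ ∀ φ ∈ S N, ∀ δ > 0, ∃ ψ ∈ T,
      ∀ x, ‖x‖ ≤ N → |φ x - ψ x| < δ := by
    intro N
    -- The dense set is taken inside `S N`, so the approximants also vanish outside the ball of
    -- radius `N`.
    obtain ⟨t, hts, htc, ht⟩ := ((TopologicalSpace.IsSeparable.of_separableSpace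
      ((fun φ : C_c(EuclideanSpace ℝ (Fin d), ℝ) => φ.toContinuousMap) '' S N))
      ).exists_countable_dense_subset
    obtain ⟨T, hTS, hTc⟩ : ∃ T ⊆ S N, T.Countable ∧
        (fun φ : C_c(EuclideanSpace ℝ (Fin d), ℝ) => φ.toContinuousMap) '' T = t := by
      choose! g hg using hts
      refine ⟨g '' t, ?_, htc.image g, ?_⟩
      · rintro _ ⟨f, hf, rfl⟩
        exact (hg hf).1
      · ext f
        constructor
        · rintro ⟨_, ⟨f', hf', rfl⟩, rfl⟩
          simpa [(hg hf').2] using hf'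
        · intro hf
          exact ⟨_, ⟨f, hf, rfl⟩, (hg hf).2⟩
    refine ⟨T, hTS, hTc.1, fun φ hφ δ hδ => ?_⟩
    have hmem := ht ⟨φ, hφ, rfl⟩
    rw [mem_closure_iff_frequently] at hmem
    have hev := ((ContinuousMap.tendsto_iff_forall_isCompact_tendstoUniformlyOn.1
      (tendsto_id (x := 𝓝 φ.toContinuousMap))) _
      (isCompact_closedBall (0 : EuclideanSpace ℝ (Fin d)) N))
    rw [Metric.tendstoUniformlyOn_iff] at hev
    obtain ⟨f, hft, hf⟩ := (hmem.and_eventually (hev δ hδ)).exists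
    rw [← hTc.2] at hft
    obtain ⟨ψ, hψ, rfl⟩ := hft
    exact ⟨ψ, hψ, fun x hx => by simpa [Real.dist_eq] using hf x (by simpa using hx)⟩
  choose T hTS hTc hT using key
  refine ⟨(⋃ N, T N) ∪ Set.range χ, (Set.countable_iUnion hTc).union (Set.countable_range _), ?_⟩
  intro φ
  obtain ⟨N, hN⟩ := exists_support_bound φ
  refine ⟨χ N, Or.inr ⟨N, rfl⟩, fun δ hδ => ?_⟩
  obtain ⟨ψ, hψ, h⟩ := hT N φ hN δ hδ
  refine ⟨ψ, Or.inl (Set.mem_iUnion.2 ⟨N, hψ⟩), fun x => ?_⟩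
  rcases le_or_gt ‖x‖ N with hx | hx
  · rw [hχ1 N x hx, mul_one]
    exact (h x hx).le
  · rw [hN x hx, hTS N hψ x hx, sub_zero, abs_zero]
    exact mul_nonneg hδ.le (hχ0 N x)

/-- Approximation of evaluations locally uniformly in the measure. -/
theorem continuousAt_ev_of_approx {X : Type*} [TopologicalSpace X] {f : X → RadonMeasure d} {a : X}
    {φ χ : C_c(EuclideanSpace ℝ (Fin d), ℝ)} (hχ : ContinuousAt (fun x => (f x).ev χ) a)
    (h : ∀ δ > 0, ∃ ψ, ContinuousAt (fun x => (f x).ev ψ) a ∧ ∀ x, |φ x - ψ x| ≤ δ * χ x) :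
    ContinuousAt (fun x => (f x).ev φ) a := by
  rw [Metric.continuousAt_iff']
  intro ε hε
  set B := |(f a).ev χ| + 1 with hB
  have hBpos : 0 < B := by positivity
  obtain ⟨ψ, hψ, hle⟩ := h (ε / (4 * B)) (by positivity)
  have h1 : ∀ᶠ x in 𝓝 a, (f x).ev χ < B :=
    hχ.eventually_lt continuousAt_const (lt_of_le_of_lt (le_abs_self _) (by linarith))
  have h2 := Metric.continuousAt_iff'.1 hψ (ε / 2) (by positivity)
  have bound : ∀ x, (f x).ev χ < B → |(f x).ev φ - (f x).ev ψ| < ε / 4 := by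
    intro x hx
    refine ((f x).abs_ev_sub_ev_le hle).trans_lt ?_
    calc ε / (4 * B) * (f x).ev χ < ε / (4 * B) * B := by gcongr
      _ = ε / 4 := by field_simp
  filter_upwards [h1, h2] with x hx1 hx2
  have e1 := bound x hx1
  have e2 := bound a h1.self_of_nhds
  rw [Real.dist_eq] at hx2 ⊢
  rw [abs_lt] at *
  constructor <;> linarith [e1.1, e1.2, e2.1, e2.2, hx2.1, hx2.2]

/-- Countably many evaluations already induce the topology. The dominating `χ` lies in the countable
family too, so its integral is locally bounded and the approximation error is locally uniform. -/
instance : SecondCountableTopology (RadonMeasure d) := by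
  obtain ⟨Φ, hc, hΦ⟩ := exists_countable_test (d := d)
  have : Countable Φ := hc.to_subtype
  let g : RadonMeasure d → Φ → ℝ := fun μ φ => μ.ev φ.1
  have hg : IsInducing g := by
    refine ⟨le_antisymm ?_ ?_⟩
    · exact (continuous_pi fun φ : Φ => continuous_ev φ.1).le_induced
    · rw [isInducing_ev.eq_induced, ← continuous_iff_le_induced]
      let _ : TopologicalSpace (RadonMeasure d) := TopologicalSpace.induced g inferInstance
      refine continuous_pi fun φ => continuous_iff_continuousAt.2 fun μ => ?_
      have hcont : ∀ ψ ∈ Φ, ContinuousAt (fun ν : RadonMeasure d => ν.ev ψ) μ := fun ψ hψ =>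
        ((continuous_apply (⟨ψ, hψ⟩ : Φ)).comp (continuous_induced_dom (f := g))).continuousAt
      obtain ⟨χ, hχ, h⟩ := hΦ φ
      refine continuousAt_ev_of_approx (f := id) (hcont χ hχ) fun δ hδ => ?_
      obtain ⟨ψ, hψ, hle⟩ := h δ hδ
      exact ⟨ψ, hcont ψ hψ, hle⟩
  exact hg.secondCountableTopology

/-! ### Joint continuity of blow-ups in the measure and the base point. -/

/-- The test function `y ↦ φ ((y - x) / r)`. -/
noncomputable def rescale (φ : C_c(EuclideanSpace ℝ (Fin d), ℝ)) (x : EuclideanSpace ℝ (Fin d))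
    {r : ℝ} (hr : 0 < r) : C_c(EuclideanSpace ℝ (Fin d), ℝ) where
  toFun y := φ (r⁻¹ • (y - x))
  continuous_toFun := by fun_prop
  hasCompactSupport' := φ.hasCompactSupport.comp_homeomorph
    ((Homeomorph.subRight x).trans (Homeomorph.smulOfNeZero r⁻¹ (inv_ne_zero hr.ne')))

theorem ev_blowUp (μ : RadonMeasure d) (x : EuclideanSpace ℝ (Fin d)) {r : ℝ} (hr : 0 < r)
    (c : ℝ≥0) (φ : C_c(EuclideanSpace ℝ (Fin d), ℝ)) :
    (μ.blowUp x hr c).ev φ = c * μ.ev (rescale φ x hr) := by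
  simp only [ev, blowUp, toMeasure]
  rw [integral_smul_nnreal_measure, integral_map]
  · rfl
  · fun_prop
  · exact φ.continuous.aestronglyMeasurable

theorem continuousAt_ev_of_eventually_close {X : Type*} [TopologicalSpace X]
    {f : X → RadonMeasure d} {φ : X → C_c(EuclideanSpace ℝ (Fin d), ℝ)} {a : X}
    {χ : C_c(EuclideanSpace ℝ (Fin d), ℝ)} (hχ : ContinuousAt (fun x => (f x).ev χ) a)
    (hφ : ContinuousAt (fun x => (f x).ev (φ a)) a)
    (h : ∀ δ > 0, ∀ᶠ x in 𝓝 a, ∀ y, |φ x y - φ a y| ≤ δ * χ y) :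
    ContinuousAt (fun x => (f x).ev (φ x)) a := by
  rw [Metric.continuousAt_iff']
  intro ε hε
  obtain ⟨B, hB⟩ := exists_gt |(f a).ev χ|
  have hBpos : 0 < B := (abs_nonneg _).trans_lt hB
  have h1 : ∀ᶠ x in 𝓝 a, (f x).ev χ < B :=
    hχ.eventually_lt continuousAt_const ((le_abs_self _).trans_lt hB)
  have h2 := Metric.continuousAt_iff'.1 hφ (ε / 2) (by positivity)
  filter_upwards [h1, h2, h (ε / (2 * B)) (by positivity)] with x hx1 hx2 hx3
  have e1 : |(f x).ev (φ x) - (f x).ev (φ a)| < ε / 2 := by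
    refine ((f x).abs_ev_sub_ev_le hx3).trans_lt ?_
    calc ε / (2 * B) * (f x).ev χ < ε / (2 * B) * B := by gcongr
      _ = ε / 2 := by field_simp
  calc dist ((f x).ev (φ x)) ((f a).ev (φ a))
      ≤ _ := dist_triangle _ ((f x).ev (φ a)) _
    _ < ε / 2 + ε / 2 := add_lt_add (by rwa [Real.dist_eq]) hx2
    _ = ε := add_halves ε

theorem rescale_eq_zero {φ : C_c(EuclideanSpace ℝ (Fin d), ℝ)} {N : ℕ}
    (hN : ∀ x, (N : ℝ) < ‖x‖ → φ x = 0) {r : ℝ} (hr : 0 < r) {z y : EuclideanSpace ℝ (Fin d)}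
    (hy : ‖z‖ + r * N < ‖y‖) : rescale φ z hr y = 0 := by
  refine hN _ ?_
  rw [norm_smul, norm_inv, Real.norm_of_nonneg hr.le, lt_inv_mul_iff₀ hr]
  have := norm_sub_norm_le y z
  linarith

theorem eventually_rescale_close (φ : C_c(EuclideanSpace ℝ (Fin d), ℝ)) {r : ℝ} (hr : 0 < r)
    (x : EuclideanSpace ℝ (Fin d)) : ∃ χ : C_c(EuclideanSpace ℝ (Fin d), ℝ), ∀ δ > 0,
      ∀ᶠ z in 𝓝 x, ∀ y, |rescale φ z hr y - rescale φ x hr y| ≤ δ * χ y := by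
  obtain ⟨N, hN⟩ := exists_support_bound φ
  -- This ball contains the supports of the rescalings at every `z` within distance `1` of `x`.
  obtain ⟨χ, hχ1, hχ0⟩ := exists_cutoff_ball (d := d) (‖x‖ + 1 + r * N)
  refine ⟨χ, fun δ hδ => ?_⟩
  obtain ⟨η, hη, hu⟩ := Metric.uniformContinuous_iff.1
    (φ.hasCompactSupport.uniformContinuous_of_continuous φ.continuous) δ hδ
  have hpos : 0 < min 1 (r * η) := lt_min one_pos (mul_pos hr hη)
  filter_upwards [Metric.ball_mem_nhds x hpos] with z hz y
  rw [Metric.mem_ball] at hz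
  rcases le_or_gt ‖y‖ (‖x‖ + 1 + r * N) with hy | hy
  · rw [hχ1 y hy, mul_one]
    refine (hu ?_).le
    rw [dist_eq_norm, ← smul_sub, norm_smul, norm_inv, Real.norm_of_nonneg hr.le,
      inv_mul_lt_iff₀ hr, sub_sub_sub_cancel_left, ← dist_eq_norm, dist_comm]
    exact hz.trans_le (min_le_right _ _)
  · have hzx := norm_sub_norm_le z x
    rw [← dist_eq_norm z x] at hzx
    have := hz.trans_le (min_le_left _ _)
    rw [rescale_eq_zero hN hr (z := z) (by linarith), rescale_eq_zero hN hr (z := x) (by linarith),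
      sub_zero, abs_zero]
    exact mul_nonneg hδ.le (hχ0 y)

theorem continuous_ev_rescale (φ : C_c(EuclideanSpace ℝ (Fin d), ℝ)) {r : ℝ} (hr : 0 < r) :
    Continuous fun p : RadonMeasure d × EuclideanSpace ℝ (Fin d) => p.1.ev (rescale φ p.2 hr) := by
  refine continuous_iff_continuousAt.2 fun p => ?_
  obtain ⟨χ, hχ⟩ := eventually_rescale_close φ hr p.2
  have hcont (ψ : C_c(EuclideanSpace ℝ (Fin d), ℝ)) : ContinuousAt
      (fun q : RadonMeasure d × EuclideanSpace ℝ (Fin d) => q.1.ev ψ) p :=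
    ((continuous_ev ψ).comp continuous_fst).continuousAt
  have hclose (δ : ℝ) (hδ : δ > 0) : ∀ᶠ q : RadonMeasure d × EuclideanSpace ℝ (Fin d) in 𝓝 p,
      ∀ y, |rescale φ q.2 hr y - rescale φ p.2 hr y| ≤ δ * χ y :=
    continuous_snd.continuousAt.eventually (hχ δ hδ)
  exact continuousAt_ev_of_eventually_close (f := Prod.fst)
    (φ := fun q => rescale φ q.2 hr) (hcont χ)
    (hcont (rescale φ p.2 hr)) hclose

theorem continuous_blowUp {r : ℝ} (hr : 0 < r) (c : ℝ≥0) :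
    Continuous fun p : RadonMeasure d × EuclideanSpace ℝ (Fin d) => p.1.blowUp p.2 hr c := by
  refine continuous_iff_ev.2 fun φ => ?_
  simp only [ev_blowUp]
  exact (continuous_ev_rescale φ hr).const_mul _

/-! ### Finitely supported measures and their density. -/

/-- The finitely supported measure with prescribed point masses. -/
noncomputable def discrete (f : EuclideanSpace ℝ (Fin d) →₀ ℝ≥0) : RadonMeasure d :=
  ⟨∑ x ∈ f.support, f x • Measure.dirac x, by
    have : IsFiniteMeasure (∑ x ∈ f.support, f x • Measure.dirac x) := inferInstance
    infer_instance⟩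

/-- The integral of a function against a finitely supported measure. -/
noncomputable def pairing (g : EuclideanSpace ℝ (Fin d) → ℝ) :
    (EuclideanSpace ℝ (Fin d) →₀ ℝ≥0) →+ ℝ :=
  Finsupp.liftAddHom fun x => (AddMonoidHom.mulRight (g x)).comp NNReal.toRealHom.toAddMonoidHom

theorem pairing_apply (g : EuclideanSpace ℝ (Fin d) → ℝ) (f : EuclideanSpace ℝ (Fin d) →₀ ℝ≥0) :
    pairing g f = f.sum fun x a => (a : ℝ) * g x := rfl

theorem pairing_smul (g : EuclideanSpace ℝ (Fin d) → ℝ) (c : ℝ≥0)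
    (f : EuclideanSpace ℝ (Fin d) →₀ ℝ≥0) : pairing g (c • f) = c * pairing g f := by
  rw [pairing_apply, pairing_apply, Finsupp.sum_smul_index (by simp), Finsupp.mul_sum]
  simp [mul_assoc]

theorem pairing_single (g : EuclideanSpace ℝ (Fin d) → ℝ) (x : EuclideanSpace ℝ (Fin d))
    (c : ℝ≥0) : pairing g (Finsupp.single x c) = c * g x := by
  rw [pairing_apply, Finsupp.sum_single_index (by simp)]

theorem ev_discrete (f : EuclideanSpace ℝ (Fin d) →₀ ℝ≥0)
    (φ : C_c(EuclideanSpace ℝ (Fin d), ℝ)) : (discrete f).ev φ = pairing φ f := by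
  simp only [ev, discrete, toMeasure]
  rw [integral_finsetSum_measure]
  · simp only [integral_smul_nnreal_measure, integral_dirac]
    rfl
  · intro x _
    exact (φ.continuous.integrable_of_hasCompactSupport φ.hasCompactSupport)

/-- Used with `s` the bad points in `K` and `α` the part carried by good points. -/
theorem discrete_apply_le {f : EuclideanSpace ℝ (Fin d) →₀ ℝ≥0}
    (α β : EuclideanSpace ℝ (Fin d) →₀ ℝ≥0) {s : Set (EuclideanSpace ℝ (Fin d))}
    (hs : MeasurableSet s) (hf : f = α + β) (h : ∀ x ∈ α.support, x ∉ s) :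
    (discrete f).toMeasure s ≤ ENNReal.ofReal (pairing 1 β) := by
  have h1 : (discrete f).toMeasure s = ∑ x ∈ f.support, s.indicator (fun x => (f x : ENNReal)) x := by
    simp only [discrete, toMeasure, Measure.finsetSum_apply]
    refine Finset.sum_congr rfl fun x _ => ?_
    rw [Measure.smul_apply, Measure.dirac_apply' _ hs]
    by_cases hx : x ∈ s <;> simp [hx, ENNReal.smul_def]
  rw [h1, pairing_apply]
  have h2 : ∀ x, s.indicator (fun x => (f x : ENNReal)) x ≤ β x := by
    intro x
    by_cases hx : x ∈ s
    · have : α x = 0 := by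
        by_contra hne
        exact h x (Finsupp.mem_support_iff.2 hne) hx
      simp [hx, hf, this]
    · simp [hx]
  have h3 : β.support ⊆ f.support := by
    intro x hx
    rw [Finsupp.mem_support_iff] at hx ⊢
    simp [hf, hx]
  calc _ ≤ ∑ x ∈ f.support, (β x : ENNReal) := Finset.sum_le_sum fun x _ => h2 x
    _ = ∑ x ∈ β.support, (β x : ENNReal) :=
        (Finset.sum_subset h3 fun x _ hx => by simpa using hx).symm
    _ = _ := by
        rw [Finsupp.sum, ← ENNReal.ofNNReal_finsetSum, ← ENNReal.ofReal_coe_nnreal]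
        simp

theorem tendsto_of_ev {ι : Type*} {l : Filter ι} {f : ι → RadonMeasure d} {μ : RadonMeasure d}
    (h : ∀ φ, Tendsto (fun i => (f i).ev φ) l (𝓝 (μ.ev φ))) : Tendsto f l (𝓝 μ) :=
  isInducing_ev.tendsto_nhds_iff.2 (tendsto_pi_nhds.2 h)

/-- The restriction to a closed ball around the origin. -/
noncomputable def restrictBall (μ : RadonMeasure d) (R : ℝ) : RadonMeasure d :=
  ⟨μ.toMeasure.restrict (Metric.closedBall 0 R), by
    have : IsFiniteMeasure (μ.toMeasure.restrict (Metric.closedBall 0 R)) :=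
      ⟨by simpa using (isCompact_closedBall 0 R).measure_lt_top⟩
    infer_instance⟩

theorem isFiniteMeasure_restrictBall (μ : RadonMeasure d) (R : ℝ) :
    IsFiniteMeasure (μ.restrictBall R).toMeasure :=
  ⟨by
    change (μ.toMeasure.restrict (Metric.closedBall 0 R)) Set.univ < _
    simpa using (isCompact_closedBall 0 R).measure_lt_top⟩

theorem tendsto_restrictBall (μ : RadonMeasure d) :
    Tendsto (fun N : ℕ => μ.restrictBall N) atTop (𝓝 μ) := by
  refine tendsto_of_ev fun φ => tendsto_const_nhds.congr' ?_
  obtain ⟨N, hN⟩ := exists_support_bound φ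
  filter_upwards [eventually_ge_atTop N] with n hn
  refine (setIntegral_eq_integral_of_forall_compl_eq_zero fun x hx => hN x ?_).symm
  have : (N : ℝ) ≤ n := by exact_mod_cast hn
  simp only [Metric.mem_closedBall, dist_zero_right, not_le] at hx
  linarith

theorem exists_discrete_map (μ : RadonMeasure d) [IsFiniteMeasure μ.toMeasure]
    (g : SimpleFunc (EuclideanSpace ℝ (Fin d)) (EuclideanSpace ℝ (Fin d))) :
    ∃ f, ∀ φ : C_c(EuclideanSpace ℝ (Fin d), ℝ),
      (discrete f).ev φ = ∫ x, φ (g x) ∂μ.toMeasure := by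
  refine ⟨∑ y ∈ g.range, Finsupp.single y (μ.toMeasure (g ⁻¹' {y})).toNNReal, fun φ => ?_⟩
  rw [ev_discrete, map_sum]
  simp only [pairing_single]
  have hφ : ∀ x, φ (g x) = ∑ y ∈ g.range, (g ⁻¹' {y}).indicator (fun _ => φ y) x := by
    intro x
    rw [Finset.sum_eq_single_of_mem (g x) (g.mem_range_self x)]
    · simp
    · intro y _ hy
      simp [hy.symm]
  simp only [hφ]
  rw [integral_finsetSum]
  · refine Finset.sum_congr rfl fun y _ => ?_
    rw [integral_indicator_const _ (g.measurableSet_fiber y)]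
    rfl
  · exact fun y _ => (integrable_const _).indicator (g.measurableSet_fiber y)

/-- Truncation to a ball reduces to finite measures; their push-forwards under simple functions
tending to the identity are discrete and converge by dominated convergence. -/
theorem dense_discrete : Dense (Set.range (discrete (d := d))) := by
  rw [← dense_closure]
  intro μ
  refine mem_closure_of_tendsto μ.tendsto_restrictBall (Eventually.of_forall fun N => ?_)
  have := μ.isFiniteMeasure_restrictBall N
  generalize μ.restrictBall N = ν at this
  have hid : Measurable (id : EuclideanSpace ℝ (Fin d) → EuclideanSpace ℝ (Fin d)) := measurable_id
  let g := fun n => SimpleFunc.approxOn id hid Set.univ 0 (Set.mem_univ _) n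
  choose f hf using fun n => exists_discrete_map ν (g n)
  refine mem_closure_of_tendsto (f := fun n => discrete (f n)) (b := atTop) ?_
    (Eventually.of_forall fun n => Set.mem_range_self _)
  refine tendsto_of_ev fun φ => ?_
  simp only [hf]
  obtain ⟨C, hC⟩ := φ.hasCompactSupport.exists_bound_of_continuous φ.continuous
  refine tendsto_integral_of_dominated_convergence (fun _ => C) (fun n => ?_)
    (integrable_const C) (fun n => Eventually.of_forall fun x => hC _)
    (Eventually.of_forall fun x => ?_)
  · exact (φ.continuous.measurable.comp (g n).measurable).aestronglyMeasurable
  · exact (φ.continuous.tendsto x).comp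
      (SimpleFunc.tendsto_approxOn hid (Set.mem_univ _) (by simp))

/-! ### Good points and openness. -/

/-- The points at which some blow-up at a scale below `δ` lies in `U`. -/
def goodPoints (U : Set (RadonMeasure d)) (δ : ℝ) (μ : RadonMeasure d) :
    Set (EuclideanSpace ℝ (Fin d)) :=
  {x | ∃ (r : ℝ) (hr : 0 < r), r < δ ∧ ∃ c : ℝ≥0, 0 < c ∧ μ.blowUp x hr c ∈ U}

theorem isOpen_goodPoints_prod {U : Set (RadonMeasure d)} (hU : IsOpen U) (δ : ℝ) :
    IsOpen {p : RadonMeasure d × EuclideanSpace ℝ (Fin d) | p.2 ∈ goodPoints U δ p.1} := by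
  refine isOpen_iff_mem_nhds.2 fun p hp => ?_
  obtain ⟨r, hr, hrδ, c, hc, h⟩ := hp
  filter_upwards [(hU.preimage (continuous_blowUp hr c)).mem_nhds h] with q hq
  exact ⟨r, hr, hrδ, c, hc, hq⟩

theorem isOpen_goodPoints {U : Set (RadonMeasure d)} (hU : IsOpen U) (δ : ℝ)
    (μ : RadonMeasure d) : IsOpen (goodPoints U δ μ) :=
  (isOpen_goodPoints_prod hU δ).preimage (f := fun x => (μ, x)) (by fun_prop)

theorem isOpen_setOf_mem_goodPoints {U : Set (RadonMeasure d)} (hU : IsOpen U) (δ : ℝ)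
    (x : EuclideanSpace ℝ (Fin d)) : IsOpen {μ : RadonMeasure d | x ∈ goodPoints U δ μ} :=
  (isOpen_goodPoints_prod hU δ).preimage (f := fun μ => (μ, x)) (by fun_prop)

theorem ofReal_ev {χ : C_c(EuclideanSpace ℝ (Fin d), ℝ)} (hχ : ∀ x, 0 ≤ χ x)
    (μ : RadonMeasure d) : ENNReal.ofReal (μ.ev χ) = ∫⁻ x, ENNReal.ofReal (χ x) ∂μ.toMeasure :=
  ofReal_integral_eq_lintegral_ofReal (μ.integrable χ) (Eventually.of_forall hχ)

/-- Upper semicontinuity of the mass of compact sets. -/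
theorem exists_isOpen_eventually_measure_lt (μ : RadonMeasure d)
    {C : Set (EuclideanSpace ℝ (Fin d))} (hC : IsCompact C) {ε : ENNReal}
    (hε : μ.toMeasure C < ε) :
    ∃ V, IsOpen V ∧ C ⊆ V ∧ ∀ᶠ ν : RadonMeasure d in 𝓝 μ, ν.toMeasure V < ε := by
  obtain ⟨V, hCV, hV, hVε⟩ := C.exists_isOpen_lt_of_lt ε hε
  obtain ⟨L, hL, hCL, hLV⟩ := exists_compact_between hC hV hCV
  obtain ⟨χ, h1, h0, hnn, hle⟩ := exists_cutoff hL hV hLV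
  -- On `interior L` the cutoff equals `1`, so its integral, continuous in `ν`, bounds the mass
  -- there.
  refine ⟨interior L, isOpen_interior, hCL, ?_⟩
  have hμ : ENNReal.ofReal (μ.ev χ) < ε := by
    refine lt_of_le_of_lt ?_ hVε
    rw [ofReal_ev hnn, ← lintegral_indicator_one hV.measurableSet]
    refine lintegral_mono fun x => ?_
    by_cases hx : x ∈ V
    · simpa [hx] using hle x
    · simp [h0 x hx]
  have hcont : Continuous fun ν : RadonMeasure d => ENNReal.ofReal (ν.ev χ) :=
    ENNReal.continuous_ofReal.comp (continuous_ev χ)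
  filter_upwards [(hcont.tendsto μ).eventually (gt_mem_nhds hμ)] with ν hν
  refine lt_of_le_of_lt ?_ hν
  rw [ofReal_ev hnn, ← lintegral_indicator_one isOpen_interior.measurableSet]
  refine lintegral_mono fun x => ?_
  by_cases hx : x ∈ interior L
  · simp [hx, h1 x (interior_subset hx)]
  · simp [hx]

/-- The measures for which the bad points in `K` have mass less than `ε`. -/
def mostlyGood (U : Set (RadonMeasure d)) (δ : ℝ) (K : Set (EuclideanSpace ℝ (Fin d)))
    (ε : ENNReal) : Set (RadonMeasure d) :=
  {μ | μ.toMeasure (K \ goodPoints U δ μ) < ε}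

/-- The bad part of `K` is compact, so some open `V` around it keeps mass below `ε` for nearby
measures. The compact set `K \ V` consists of good points and stays good for nearby measures by the
tube lemma. -/
theorem isOpen_mostlyGood {U : Set (RadonMeasure d)} (hU : IsOpen U) (δ : ℝ)
    {K : Set (EuclideanSpace ℝ (Fin d))} (hK : IsCompact K) (ε : ENNReal) :
    IsOpen (mostlyGood U δ K ε) := by
  refine isOpen_iff_mem_nhds.2 fun μ hμ => ?_
  obtain ⟨V, hV, hCV, hVε⟩ :=
    μ.exists_isOpen_eventually_measure_lt (hK.diff (isOpen_goodPoints hU δ μ)) hμ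
  have htube : ∀ᶠ ν : RadonMeasure d in 𝓝 μ, ∀ x ∈ K \ V, x ∈ goodPoints U δ ν := by
    refine (hK.diff hV).eventually_forall_of_forall_eventually fun x hx => ?_
    refine (isOpen_goodPoints_prod hU δ).mem_nhds (x := (μ, x)) ?_
    by_contra h
    exact hx.2 (hCV ⟨hx.1, h⟩)
  filter_upwards [hVε, htube] with ν h1 h2
  refine (measure_mono ?_).trans_lt h1
  intro x hx
  by_contra h
  exact hx.2 (h2 x ⟨hx.1, h⟩)

/-! ### Density by smearing atoms. -/

theorem exists_discrete_mem_pos {U : Set (RadonMeasure d)} (hU : IsOpen U) (hne : U.Nonempty) :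
    ∃ η : EuclideanSpace ℝ (Fin d) →₀ ℝ≥0, discrete η ∈ U ∧ 0 < η 0 := by
  obtain ⟨_, hf, ⟨f, rfl⟩⟩ := dense_discrete.inter_open_nonempty U hU hne
  have ht : Tendsto (fun t : ℝ≥0 => discrete (f + Finsupp.single 0 t)) (𝓝[>] 0) (𝓝 (discrete f)) := by
    refine tendsto_of_ev fun φ => ?_
    simp only [ev_discrete, map_add, pairing_single]
    have : Continuous fun t : ℝ≥0 => pairing φ f + t * φ 0 := by fun_prop
    simpa using this.continuousWithinAt.tendsto (s := Set.Ioi 0) (x := 0)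
  obtain ⟨t, h, ht⟩ := ((ht.eventually (hU.mem_nhds hf)).and self_mem_nhdsWithin).exists
  exact ⟨_, h, by simpa using Or.inr ht⟩

/-- Each point mass is replaced by a copy of `ξ` at scale `r`. -/
noncomputable def smear (ξ : EuclideanSpace ℝ (Fin d) →₀ ℝ≥0) (r : ℝ)
    (β : EuclideanSpace ℝ (Fin d) →₀ ℝ≥0) : EuclideanSpace ℝ (Fin d) →₀ ℝ≥0 :=
  β.sum fun x b => b • ξ.mapDomain fun y => x + r • y

theorem pairing_smear (g : EuclideanSpace ℝ (Fin d) → ℝ)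
    (ξ β : EuclideanSpace ℝ (Fin d) →₀ ℝ≥0) (r : ℝ) :
    pairing g (smear ξ r β) = β.sum fun x b => (b : ℝ) * pairing (fun y => g (x + r • y)) ξ := by
  simp only [smear, Finsupp.sum, map_sum, pairing_smul]
  refine Finset.sum_congr rfl fun x _ => ?_
  congr 1
  rw [pairing_apply, Finsupp.sum_mapDomain_index (by simp) (by intros; push_cast; ring)]
  rfl

/-- The copies of `ξ` collapse to their centres as the scale shrinks. -/
theorem tendsto_pairing_smear {ξ : EuclideanSpace ℝ (Fin d) →₀ ℝ≥0}
    (β : EuclideanSpace ℝ (Fin d) →₀ ℝ≥0) {g : EuclideanSpace ℝ (Fin d) → ℝ} (hg : Continuous g) :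
    Tendsto (fun r => pairing g (smear ξ r β)) (𝓝[>] 0) (𝓝 (pairing 1 ξ * pairing g β)) := by
  have hc : Continuous fun r => pairing g (smear ξ r β) := by
    simp only [pairing_smear]
    simp only [pairing_apply, Finsupp.sum]
    fun_prop
  have h0 : pairing g (smear ξ 0 β) = pairing 1 ξ * pairing g β := by
    rw [pairing_smear]
    simp only [pairing_apply, Finsupp.sum, zero_smul, add_zero, Pi.one_apply, mul_one,
      ← Finset.sum_mul, Finset.mul_sum]
    refine Finset.sum_congr rfl fun x _ => by ring
  rw [← h0]
  exact hc.continuousWithinAt.tendsto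

/-- The function is eventually constant: at `z = x` the two scalings cancel, and otherwise the
rescaled point leaves the support of `φ`. -/
theorem tendsto_comp_rescale (φ : C_c(EuclideanSpace ℝ (Fin d), ℝ))
    (x y z : EuclideanSpace ℝ (Fin d)) [Decidable (z = x)] :
    Tendsto (fun r : ℝ => φ (r⁻¹ • (z + r • y - x))) (𝓝[>] 0) (𝓝 (if z = x then φ y else 0)) := by
  refine tendsto_const_nhds.congr' ?_
  split_ifs with h
  · filter_upwards [self_mem_nhdsWithin] with r hr
    rw [h, add_sub_cancel_left, inv_smul_smul₀ (ne_of_gt hr)]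
  · obtain ⟨N, hN⟩ := exists_support_bound φ
    have h1 : ContinuousAt (fun r : ℝ => ‖z + r • y - x‖ - r * N) 0 := by fun_prop
    have h2 : ∀ᶠ r in 𝓝 (0 : ℝ), 0 < ‖z + r • y - x‖ - r * N :=
      h1.eventually (lt_mem_nhds (by simpa [sub_eq_zero] using h))
    filter_upwards [self_mem_nhdsWithin, h2.filter_mono nhdsWithin_le_nhds] with r hr hlt
    have hr : 0 < r := hr
    refine (hN _ ?_).symm
    rw [norm_smul, norm_inv, Real.norm_of_nonneg hr.le, lt_inv_mul_iff₀ hr]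
    linarith

/-- Blowing up at `x` at the smearing scale shows only the copy centred at `x`; all other mass
escapes to infinity. -/
theorem tendsto_pairing_rescale_smear (φ : C_c(EuclideanSpace ℝ (Fin d), ℝ))
    (α β ξ : EuclideanSpace ℝ (Fin d) →₀ ℝ≥0) {x : EuclideanSpace ℝ (Fin d)}
    (hα : α x = 0) :
    Tendsto (fun r : ℝ => pairing (fun z => φ (r⁻¹ • (z - x))) (α + smear ξ r β)) (𝓝[>] 0)
      (𝓝 (β x * pairing φ ξ)) := by
  classical
  have h1 : Tendsto (fun r : ℝ => pairing (fun z => φ (r⁻¹ • (z - x))) α) (𝓝[>] 0) (𝓝 0) := by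
    rw [← Finset.sum_const_zero (s := α.support)]
    refine tendsto_finsetSum _ fun z hz => ?_
    have hzx : z ≠ x := by
      rintro rfl
      exact (Finsupp.mem_support_iff.1 hz) hα
    simpa [hzx] using (tendsto_comp_rescale φ x 0 z).const_mul (α z : ℝ)
  have h2 : Tendsto (fun r : ℝ => pairing (fun z => φ (r⁻¹ • (z - x))) (smear ξ r β)) (𝓝[>] 0)
      (𝓝 (β x * pairing φ ξ)) := by
    have e : β x * pairing φ ξ = ∑ z ∈ β.support,
        (β z : ℝ) * ∑ y ∈ ξ.support, (ξ y : ℝ) * if z = x then φ y else 0 := by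
      rw [Finset.sum_eq_single x]
      · simp [pairing_apply, Finsupp.sum]
      · intro z _ hz
        simp [hz]
      · intro hx
        simp [Finsupp.notMem_support_iff.1 hx]
    simp only [pairing_smear]
    rw [e]
    exact tendsto_finsetSum _ fun z _ => (tendsto_finsetSum _ fun y _ =>
      (tendsto_comp_rescale φ x y z).const_mul (ξ y : ℝ)).const_mul (β z : ℝ)
  simpa using h1.add h2

theorem eventually_mem_goodPoints_smear {U : Set (RadonMeasure d)} (hU : IsOpen U) {δ : ℝ}
    (hδ : 0 < δ) {α β η ξ : EuclideanSpace ℝ (Fin d) →₀ ℝ≥0} {B : ℝ≥0} (hB : 0 < B)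
    (hη : η = B • ξ) (hηU : discrete η ∈ U) {x : EuclideanSpace ℝ (Fin d)} (hα : α x = 0)
    (hβ : 0 < β x) :
    ∀ᶠ r in 𝓝[>] (0 : ℝ), x ∈ goodPoints U δ (discrete (α + smear ξ r β)) := by
  obtain ⟨O, hO, rfl⟩ := isInducing_ev.isOpen_iff.1 hU
  have hlim : Tendsto (fun (r : ℝ) (φ : C_c(EuclideanSpace ℝ (Fin d), ℝ)) => ((B / β x : ℝ≥0) : ℝ) *
      pairing (fun z => φ (r⁻¹ • (z - x))) (α + smear ξ r β)) (𝓝[>] 0) (𝓝 (discrete η).ev) := by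
    refine tendsto_pi_nhds.2 fun φ => ?_
    convert (tendsto_pairing_rescale_smear φ α β ξ hα).const_mul ((B / β x : ℝ≥0) : ℝ) using 2
    rw [ev_discrete, hη, pairing_smul, NNReal.coe_div, ← mul_assoc,
      div_mul_cancel₀ _ (NNReal.coe_ne_zero.2 hβ.ne')]
  filter_upwards [hlim.eventually (hO.mem_nhds hηU), Ioo_mem_nhdsGT hδ] with r hr hrδ
  -- The limiting blow-up is `β x • ξ`; the factor `B / β x` turns it into `B • ξ = η`.
  refine ⟨r, hrδ.1, hrδ.2, B / β x, div_pos hB hβ, ?_⟩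
  have e : ((discrete (α + smear ξ r β)).blowUp x hrδ.1 (B / β x)).ev = fun φ =>
      ((B / β x : ℝ≥0) : ℝ) * pairing (fun z => φ (r⁻¹ • (z - x))) (α + smear ξ r β) := by
    ext φ
    rw [ev_blowUp, ev_discrete]
    rfl
  rw [Set.mem_preimage, e]
  exact hr

/-- One smearing step makes all points good except for a fixed proportion of the bad mass. -/
theorem exists_smear_step {U W : Set (RadonMeasure d)} (hU : IsOpen U) (hW : IsOpen W) {δ : ℝ}
    (hδ : 0 < δ) {η ξ ζ : EuclideanSpace ℝ (Fin d) →₀ ℝ≥0} {B p : ℝ≥0} (hB : 0 < B)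
    (hη : η = B • ξ) (hξ : pairing 1 ξ = 1) (hζ : ξ = Finsupp.single 0 p + ζ)
    (hηU : discrete η ∈ U) {α β : EuclideanSpace ℝ (Fin d) →₀ ℝ≥0} (hαβ : discrete (α + β) ∈ W)
    (hα : ∀ x ∈ α.support, x ∈ goodPoints U δ (discrete (α + β))) :
    ∃ α' β' : EuclideanSpace ℝ (Fin d) →₀ ℝ≥0, discrete (α' + β') ∈ W ∧
      (∀ x ∈ α'.support, x ∈ goodPoints U δ (discrete (α' + β'))) ∧
      pairing 1 β' = pairing 1 ζ * pairing 1 β := by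
  have hlim : Tendsto (fun r => discrete (α + smear ξ r β)) (𝓝[>] 0) (𝓝 (discrete (α + β))) := by
    refine tendsto_of_ev fun φ => ?_
    simp only [ev_discrete, map_add]
    simpa [hξ] using (tendsto_pairing_smear (ξ := ξ) β φ.continuous).const_add (pairing φ α)
  have hgood : ∀ᶠ r in 𝓝[>] (0 : ℝ), ∀ x ∈ α.support ∪ β.support,
      x ∈ goodPoints U δ (discrete (α + smear ξ r β)) := by
    refine (Finset.eventually_all _).2 fun x hx => ?_
    -- Atoms of `β` outside `α` become good through their own copies; atoms of `α` were good and
    -- remain so because goodness is open in the measure.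
    by_cases hxα : α x = 0
    · have hxβ : β x ≠ 0 := by simpa [hxα] using hx
      exact eventually_mem_goodPoints_smear hU hδ hB hη hηU hxα (pos_iff_ne_zero.2 hxβ)
    · exact hlim.eventually ((isOpen_setOf_mem_goodPoints hU δ x).mem_nhds
        (hα x (Finsupp.mem_support_iff.2 hxα)))
  obtain ⟨r, hrW, hr⟩ := ((hlim.eventually (hW.mem_nhds hαβ)).and hgood).exists
  -- The atom of `ξ` at `0` leaves `p • β` in place, which joins the good part; the copies of `ζ`
  -- form the new bad part.
  have hsplit : α + p • β + smear ζ r β = α + smear ξ r β := by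
    rw [add_assoc, hζ]
    congr 1
    simp only [smear, Finsupp.mapDomain_add, smul_add, Finsupp.mapDomain_single, smul_zero,
      add_zero, Finsupp.sum_add]
    congr 1
    conv_lhs => rw [← β.sum_single, Finsupp.smul_sum]
    simp [mul_comm]
  refine ⟨α + p • β, smear ζ r β, by rwa [hsplit], ?_, ?_⟩
  · intro x hx
    rw [hsplit]
    refine hr x ?_
    by_contra h
    simp only [Finset.mem_union, Finsupp.mem_support_iff, not_or, not_not] at h
    simp [h.1, h.2] at hx
  · rw [pairing_smear, pairing_apply 1 β, Finsupp.mul_sum]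
    refine Finset.sum_congr rfl fun x _ => ?_
    change (β x : ℝ) * pairing 1 ζ = pairing 1 ζ * (β x * 1)
    ring

theorem pairing_one_nonneg (f : EuclideanSpace ℝ (Fin d) →₀ ℝ≥0) : 0 ≤ pairing 1 f :=
  Finset.sum_nonneg fun x _ => by simp

/-- Normalization of a finitely supported measure charging the origin. -/
theorem exists_normalization {η : EuclideanSpace ℝ (Fin d) →₀ ℝ≥0} (h0 : 0 < η 0) :
    ∃ (B p : ℝ≥0) (ξ ζ : EuclideanSpace ℝ (Fin d) →₀ ℝ≥0), 0 < B ∧ η = B • ξ ∧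
      pairing 1 ξ = 1 ∧ ξ = Finsupp.single 0 p + ζ ∧ pairing 1 ζ < 1 := by
  set B : ℝ≥0 := ⟨pairing 1 η, pairing_one_nonneg η⟩ with hB
  have hsplit : η = Finsupp.single 0 (η 0) + η.erase 0 := (Finsupp.single_add_erase 0 η).symm
  have hBpos : 0 < B := by
    rw [← NNReal.coe_pos]
    change 0 < pairing 1 η
    rw [hsplit, map_add, pairing_single]
    have : (0 : ℝ) < η 0 := h0
    have := pairing_one_nonneg (η.erase 0)
    simp only [Pi.one_apply, mul_one]
    linarith
  have hξ : pairing 1 (B⁻¹ • η) = 1 := by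
    rw [pairing_smul, NNReal.coe_inv]
    exact inv_mul_cancel₀ (NNReal.coe_ne_zero.2 hBpos.ne')
  have hζ : B⁻¹ • η = Finsupp.single 0 (B⁻¹ * η 0) + B⁻¹ • η.erase 0 := by
    conv_lhs => rw [hsplit]
    rw [smul_add, Finsupp.smul_single, smul_eq_mul]
  refine ⟨B, B⁻¹ * η 0, B⁻¹ • η, B⁻¹ • η.erase 0, hBpos, (smul_inv_smul₀ hBpos.ne' η).symm, hξ,
    hζ, ?_⟩
  have hp : (0 : ℝ) < (B⁻¹ * η 0 : ℝ≥0) := NNReal.coe_pos.2 (mul_pos (inv_pos.2 hBpos) h0)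
  rw [hζ, map_add, pairing_single, Pi.one_apply, mul_one] at hξ
  linarith

theorem dense_mostlyGood {U : Set (RadonMeasure d)} (hU : IsOpen U) (hne : U.Nonempty) {δ : ℝ}
    (hδ : 0 < δ) {K : Set (EuclideanSpace ℝ (Fin d))} (hK : IsCompact K) {ε : ENNReal}
    (hε : 0 < ε) : Dense (mostlyGood U δ K ε) := by
  obtain ⟨η, hηU, h0⟩ := exists_discrete_mem_pos hU hne
  obtain ⟨B, p, ξ, ζ, hB, hη, hξ, hζ, hlt⟩ := exists_normalization h0
  refine dense_iff_inter_open.2 fun W hW hWne => ?_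
  obtain ⟨_, hf, ⟨f, rfl⟩⟩ := dense_discrete.inter_open_nonempty W hW hWne
  have key : ∀ n : ℕ, ∃ α β : EuclideanSpace ℝ (Fin d) →₀ ℝ≥0, discrete (α + β) ∈ W ∧
      (∀ x ∈ α.support, x ∈ goodPoints U δ (discrete (α + β))) ∧
      pairing 1 β = pairing 1 ζ ^ n * pairing 1 f := by
    intro n
    induction n with
    -- Initially all the mass counts as bad.
    | zero => exact ⟨0, f, by simpa using hf, by simp, by simp⟩
    | succ n ih =>
      obtain ⟨α, β, h1, h2, h3⟩ := ih
      obtain ⟨α', β', h1', h2', h3'⟩ := exists_smear_step hU hW hδ hB hη hξ hζ hηU h1 h2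
      exact ⟨α', β', h1', h2', by rw [h3', h3, pow_succ']; ring⟩
  have hlim : Tendsto (fun n : ℕ => ENNReal.ofReal (pairing 1 ζ ^ n * pairing 1 f)) atTop (𝓝 0) := by
    rw [← ENNReal.ofReal_zero, ← zero_mul (pairing 1 f)]
    exact ENNReal.tendsto_ofReal
      ((tendsto_pow_atTop_nhds_zero_of_lt_one (pairing_one_nonneg ζ) hlt).mul_const _)
  obtain ⟨n, hn⟩ := (hlim.eventually (gt_mem_nhds hε)).exists
  obtain ⟨α, β, h1, h2, h3⟩ := key n
  refine ⟨_, h1, lt_of_le_of_lt ?_ hn⟩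
  rw [← h3]
  exact discrete_apply_le α β (hK.measurableSet.diff (isOpen_goodPoints hU δ _).measurableSet) rfl
    fun x hx hmem => hmem.2 (h2 x hx)

/-! ### Residuality and the choice of radii. -/

theorem eventually_ae_mem_goodPoints {U : Set (RadonMeasure d)} (hU : IsOpen U) (hne : U.Nonempty)
    {δ : ℝ} (hδ : 0 < δ) : ∀ᶠ μ : RadonMeasure d in residual (RadonMeasure d),
      ∀ᵐ x ∂μ.toMeasure, x ∈ goodPoints U δ μ := by
  have h : ∀ᶠ μ : RadonMeasure d in residual (RadonMeasure d), ∀ m n : ℕ,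
      μ ∈ mostlyGood U δ (Metric.closedBall 0 m) (n + 1 : ENNReal)⁻¹ :=
    eventually_countable_forall.2 fun m => eventually_countable_forall.2 fun n =>
      residual_of_dense_open (isOpen_mostlyGood hU δ (isCompact_closedBall _ _) _)
        (dense_mostlyGood hU hne hδ (isCompact_closedBall _ _) (by simp))
  filter_upwards [h] with μ hμ
  have hzero : ∀ m : ℕ, μ.toMeasure (Metric.closedBall 0 m \ goodPoints U δ μ) = 0 := by
    intro m
    by_contra hne
    obtain ⟨n, hn⟩ := ENNReal.exists_inv_nat_lt hne
    have hle : (n + 1 : ENNReal)⁻¹ ≤ (n : ENNReal)⁻¹ := ENNReal.inv_le_inv.2 le_self_add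
    exact lt_irrefl _ ((hμ m n).trans_le (hle.trans hn.le))
  rw [ae_iff]
  refine measure_mono_null ?_ (measure_iUnion_null hzero)
  intro x hx
  obtain ⟨m, hm⟩ := exists_nat_ge ‖x‖
  exact Set.mem_iUnion.2 ⟨m, by simpa using hm, hx⟩

theorem mem_tangentMeasures {μ ν : RadonMeasure d} {x : EuclideanSpace ℝ (Fin d)} (hν : ν ≠ 0)
    (h : ∀ U ∈ 𝓝 ν, ∀ δ > 0, x ∈ goodPoints U δ μ) : ν ∈ μ.tangentMeasures x := by
  obtain ⟨V, hV⟩ := (𝓝 ν).exists_antitone_basis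
  choose ρ hρ hρδ c hc hmem using fun (n : ℕ) (δ : {δ : ℝ // 0 < δ}) =>
    h (V n) (hV.mem n) δ.1 δ.2
  -- Each new radius is kept below the previous one and below `1 / (n + 1)`. The starting value `1`
  -- of `R` is only a seed: the sequence used begins with `R 1`.
  let bound : ℕ → {δ : ℝ // 0 < δ} → {δ : ℝ // 0 < δ} := fun n δ =>
    ⟨min δ.1 (1 / (n + 1)), lt_min δ.2 (by positivity)⟩
  let R : ℕ → {δ : ℝ // 0 < δ} := fun n => n.rec ⟨1, one_pos⟩
    fun n δ => ⟨ρ n (bound n δ), hρ _ _⟩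
  have hR : ∀ n, (R (n + 1)).1 < min (R n).1 (1 / (n + 1)) := fun n => hρδ n (bound n (R n))
  refine ⟨hν, fun n => (R (n + 1)).1, fun n => (R (n + 1)).2, fun n => c n (bound n (R n)), ?_, ?_,
    fun n => hc n _, ?_⟩
  · exact strictAnti_nat_of_succ_lt fun n => (hR (n + 1)).trans_le (min_le_left _ _)
  · exact squeeze_zero (fun n => (R (n + 1)).2.le) (fun n => ((hR n).trans_le (min_le_right _ _)).le)
      tendsto_one_div_add_atTop_nhds_zero_nat
  · exact hV.tendsto fun n => hmem n (bound n (R n))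

theorem goodPoints_mono {U V : Set (RadonMeasure d)} (hUV : U ⊆ V) {δ δ' : ℝ} (hδ : δ ≤ δ')
    (μ : RadonMeasure d) : goodPoints U δ μ ⊆ goodPoints V δ' μ :=
  fun _ ⟨r, hr, hrδ, c, hc, h⟩ => ⟨r, hr, hrδ.trans_le hδ, c, hc, hUV h⟩

end RadonMeasure

open RadonMeasure TopologicalSpace in
theorem theorem1 (d : ℕ) :
    ∀ᶠ μ : RadonMeasure d in residual (RadonMeasure d),
      ∀ᵐ x ∂μ.toMeasure, μ.tangentMeasures x = {ν : RadonMeasure d | ν ≠ 0} := by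
  have : Countable (countableBasis (RadonMeasure d)) := (countable_countableBasis _).to_subtype
  have h : ∀ᶠ μ : RadonMeasure d in residual (RadonMeasure d),
      ∀ (U : countableBasis (RadonMeasure d)) (n : ℕ),
        ∀ᵐ x ∂μ.toMeasure, x ∈ goodPoints U (1 / (n + 1)) μ :=
    eventually_countable_forall.2 fun U => eventually_countable_forall.2 fun n =>
      eventually_ae_mem_goodPoints (isOpen_of_mem_countableBasis U.2)
        (nonempty_of_mem_countableBasis U.2) (by positivity)
  filter_upwards [h] with μ hμ
  -- Countability of the basis gives one null set valid for all `U` and `n`.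
  filter_upwards [ae_all_iff.2 fun U => ae_all_iff.2 (hμ U)] with x hx
  refine Set.Subset.antisymm (fun ν hν => hν.1) fun ν hν => mem_tangentMeasures hν ?_
  intro V hV δ hδ
  obtain ⟨U, hU, -, hUV⟩ := (isBasis_countableBasis (RadonMeasure d)).mem_nhds_iff.1 hV
  obtain ⟨n, hn⟩ := exists_nat_one_div_lt hδ
  exact goodPoints_mono hUV hn.le μ (hx ⟨U, hU⟩ n)
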